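/- Let $\Omega$ be a Polish space with its Borel $\sigma$-algebra, $\pi$ and $\pi_0$ probability measures on $\Omega$, and $P$ a Markov transition kernel on $\Omega$ with invariant distribution $\pi$. Let $\bar P$ be a Markov kernel on $\Omega\times\Omega$ with $\bar P((x,y),A\times\Omega)=P(x,A)$ and $\bar P((x,y),\Omega\times A)=P(y,A)$ for all $x,y\in\Omega$ and all measurable $A$. Let $(Y_t)_{t\ge0}$, $(Z_t)_{t\ge0}$ be such that $Y_0\sim\pi_0$, $Y_1\sim P(Y_0,\cdot)$, $Z_0\sim\pi_0$ is independent of $(Y_0,Y_1)$, and, given the past, $(Y_t,Z_{t-1})\sim\bar P((Y_{t-1},Z_{t-2}),\cdot)$ for each $t\ge2$. Let $\tau=\inf\{t\ge1: Y_t=Z_{t-1}\}$, and suppose that the coupling is faithful: almost surely $Y_t=Z_{t-1}$ for every $t\ge\tau$. Suppose that $P$ is $\phi$-irreducible and aperiodic and satisfies a geometric drift condition: there are a measurable $V:\Omega\to[1,\infty)$ and constants $\lambda\in(0,1)$, $b,L\in\mathbb R$ such that, with $\mathcal S=\{x: V(x)\le L\}$, $$\int P(x,\mathrm dy)\,V(y)\le\lambda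 V(x)+b\,\mathbf 1(x\in\mathcal S)\quad\text{for all }x\in\Omega,\qquad \lambda+\frac{b}{1+L}<1,$$ and $\mathcal S$ is a small set, i.e. there are $n\ge1$, $\epsilon>0$ and a probability measure $\nu$ on $\Omega$ with $P^n(x,\cdot)\ge\epsilon\,\nu(\cdot)$ for all $x\in\mathcal S$. Suppose that $\int V\,\mathrm d\pi_0<\infty$. Suppose that there is $\tilde\epsilon\in(0,1)$ such that $$\inf_{(x,y)\in\mathcal S\times\mathcal S}\bar P\big((x,y),\{(z,z):z\in\Omega\}\big)\ge\tilde\epsilon.$$ Let $f:\Omega\to\mathbb R^m$ be measurable, let $l>0$, and suppose that there are $p>l$ and $D_p>0$ with $\mathbb E\big[\sum_{i=1}^m|f_i(Y_t)|^p\big]<D_p$ for every $t\ge0$. Then $\tau<\infty$ almost surely, and for every $k\ge0$ the Jacob--O'Leary--Atchadé (JOA) estimator $$H_k(Y,Z)=f(Y_k)+\sum_{i=k+1}^{\tau-1}\big(f(Y_i)-f(Z_{i-1})\big)$$ (the sum being $0$ if $\tau-1<k+1$) satisfies $\mathbb E\big[\sum_{i=1}^m|H_{k,i}(Y,Z)|^l\big]<\infty$.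 In particular, if $\alpha>0$ and $l>2+\alpha$, then $H_k(Y,Z)$ satisfies the moment assumption for $\alpha$: there is some $l'>2+\alpha$ with $\mathbb E\big[\sum_{i=1}^m|H_{k,i}(Y,Z)|^{l'}\big]<\infty$. -/

import Mathlib

open MeasureTheory ProbabilityTheory
open scoped ENNReal

/-- `x ↦ P(x, ·)` admits an irreducibility measure: a nonzero `σ`-finite measure `φ` such that every
measurable set of positive `φ`-measure is reached with positive probability from every state. -/
def IsPhiIrreducible {Ω : Type*} [MeasurableSpace Ω] (P : Kernel Ω Ω) : Prop :=
  ∃ φ : Measure Ω, SigmaFinite φ ∧ φ ≠ 0 ∧ Kernel.IsIrreducible φ P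

/-- Aperiodicity of an irreducible kernel: there is no `d`-cycle with `d ≥ 2`, a `d`-cycle being a
family of disjoint measurable sets `D₀, …, D_{d-1}` with `P(x, D_{i+1}) = 1` for `x ∈ D_i` (indices
modulo `d`), such that the complement of their union is null for the maximal irreducibility measure,
that is, for every irreducibility measure. -/
def IsAperiodicKernel {Ω : Type*} [MeasurableSpace Ω] (P : Kernel Ω Ω) : Prop :=
  ∀ d : ℕ, 2 ≤ d → ¬ ∃ D : ZMod d → Set Ω,
    (∀ i, MeasurableSet (D i)) ∧
    Pairwise (fun i j => Disjoint (D i) (D j)) ∧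
    (∀ i, ∀ x ∈ D i, P x (D (i + 1)) = 1) ∧
    (∀ φ : Measure Ω, Kernel.IsIrreducible φ P → φ (⋃ i, D i)ᶜ = 0)

/-- `S` is a small set: `P^n(x, ·) ≥ ε ν(·)` for all `x ∈ S`, for some `n ≥ 1`, `ε > 0` and some
probability measure `ν`. -/
def IsSmallSet {Ω : Type*} [MeasurableSpace Ω] (P : Kernel Ω Ω) (S : Set Ω) : Prop :=
  ∃ n : ℕ, 0 < n ∧ ∃ ε : ℝ, 0 < ε ∧ ∃ ν : Measure Ω, IsProbabilityMeasure ν ∧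
    ∀ x ∈ S, ∀ B, MeasurableSet B → ENNReal.ofReal ε * ν B ≤ (P ^ n) x B

/-- The geometric drift condition for the `π`-invariant kernel `P`, with drift function `V`, rate
`lam`, constant `b` and set `S`. -/
structure GeometricDrift {Ω : Type*} [MeasurableSpace Ω] (P : Kernel Ω Ω) (π : Measure Ω)
    (V : Ω → ℝ) (lam b : ℝ) (S : Set Ω) : Prop where
  invariant : Kernel.Invariant P π
  irreducible : IsPhiIrreducible P
  aperiodic : IsAperiodicKernel P
  measurable_V : Measurable V
  one_le_V : ∀ x, 1 ≤ V x
  lam_pos : 0 < lam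
  lam_lt_one : lam < 1
  measurableSet_S : MeasurableSet S
  drift : ∀ x, ∫⁻ y, ENNReal.ofReal (V y) ∂(P x) ≤
    ENNReal.ofReal (lam * V x + S.indicator (fun _ => b) x)

/-- `Pbar` is a coupling of `P` with itself: its two marginals are `P(x, ·)` and `P(y, ·)`. -/
def IsKernelCoupling {Ω : Type*} [MeasurableSpace Ω] (P : Kernel Ω Ω)
    (Pbar : Kernel (Ω × Ω) (Ω × Ω)) : Prop :=
  ∀ x y : Ω, ∀ A : Set Ω, MeasurableSet A →
    Pbar (x, y) (A ×ˢ Set.univ) = P x A ∧ Pbar (x, y) (Set.univ ×ˢ A) = P y A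

/-- The `σ`-algebra generated by `Y_0, …, Y_{n+1}` and `Z_0, …, Z_n`. -/
abbrev coupledHistory {Ω E : Type*} [MeasurableSpace Ω] (Y Z : ℕ → E → Ω) (n : ℕ) :
    MeasurableSpace E :=
  (⨆ i ∈ Set.Iic (n + 1), MeasurableSpace.comap (Y i) inferInstance) ⊔
    (⨆ i ∈ Set.Iic n, MeasurableSpace.comap (Z i) inferInstance)

/-- The coupled pair of chains with lag one: `Y_0 ∼ π₀`, `Y_1 ∼ P(Y_0, ·)`, `Z_0 ∼ π₀` independent of
`(Y_0, Y_1)`, and, given the past, `(Y_{n+2}, Z_{n+1}) ∼ Pbar((Y_{n+1}, Z_n), ·)` for `n ≥ 0`. -/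
structure IsLaggedCoupledChain {Ω E : Type*} [MeasurableSpace Ω] [MeasurableSpace E]
    (μ : Measure E) (π₀ : Measure Ω) (P : Kernel Ω Ω) (Pbar : Kernel (Ω × Ω) (Ω × Ω))
    (Y Z : ℕ → E → Ω) : Prop where
  measurable_Y : ∀ t, Measurable (Y t)
  measurable_Z : ∀ t, Measurable (Z t)
  initial : μ.map (fun ω => ((Y 0 ω, Y 1 ω), Z 0 ω)) = (π₀ ⊗ₘ P).prod π₀
  markov : ∀ n : ℕ, ∀ A : Set E, MeasurableSet[coupledHistory Y Z n] A →
    ∀ C : Set (Ω × Ω), MeasurableSet C →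
      μ (A ∩ {ω | (Y (n + 2) ω, Z (n + 1) ω) ∈ C}) = ∫⁻ ω in A, Pbar (Y (n + 1) ω, Z n ω) C ∂μ

/-- The meeting time `τ = inf {t ≥ 1 : Y_t = Z_{t-1}}`, infinite if the chains never meet. -/
noncomputable def meetingTime {Ω E : Type*} (Y Z : ℕ → E → Ω) (ω : E) : ℕ∞ :=
  ⨅ t : ℕ, ⨅ _ : 1 ≤ t ∧ Y t ω = Z (t - 1) ω, (t : ℕ∞)

/-- The chains stay together after meeting: almost surely `Y_t = Z_{t-1}` for all `t ≥ τ`. -/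
def StaysTogether {Ω E : Type*} [MeasurableSpace E] (μ : Measure E) (Y Z : ℕ → E → Ω) : Prop :=
  ∀ᵐ ω ∂μ, ∀ t : ℕ, meetingTime Y Z ω ≤ (t : ℕ∞) → Y t ω = Z (t - 1) ω

/-- The estimator `H_k(Y,Z) = f(Y_k) + ∑_{i=k+1}^{τ-1} (f(Y_i) - f(Z_{i-1}))`. It is meaningful on
the event `τ < ∞`. -/
noncomputable def joaEstimator {Ω E : Type*} {m : ℕ} (f : Ω → Fin m → ℝ) (Y Z : ℕ → E → Ω)
    (k : ℕ) (ω : E) : Fin m → ℝ :=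
  f (Y k ω) + ∑ i ∈ Finset.Ico (k + 1) (meetingTime Y Z ω).toNat, (f (Y i ω) - f (Z (i - 1) ω))

/-- `𝔼[‖X‖_q^q] = 𝔼[∑_i |X_i|^q]`, with values in `[0, ∞]`. -/
noncomputable def lqMoment {E : Type*} [MeasurableSpace E] {m : ℕ} (μ : Measure E) (q : ℝ)
    (X : E → Fin m → ℝ) : ℝ≥0∞ :=
  ∫⁻ ω, ∑ i, ENNReal.ofReal (|X ω i| ^ q) ∂μ

/-- The moment assumption on an estimator `H` for the Hölder exponent `α`: some moment of order
strictly larger than `2 + α` is finite. -/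
def MomentAssumption {E : Type*} [MeasurableSpace E] {m : ℕ} (μ : Measure E) (α : ℝ)
    (H : E → Fin m → ℝ) : Prop :=
  ∃ l : ℝ, 2 + α < l ∧ lqMoment μ l H < ∞

/-! Two estimates combine: geometric tails for the meeting time, and a moment bound for a series of
variables supported on events of geometrically small probability.

Tails: the coupled kernel killed on the diagonal contracts `V x + V y + c`
(`IsKernelCoupling.exists_contraction`). If a point lies outside the sublevel set, then `V x + V y ≥
1 + L` absorbs `b`, and the drift contracts. If both lie inside, `V` may grow by a bounded amount,
but meeting removes a fraction `ε` of the constant `c`, which wins once `c` is large. Iterating on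
the event of not having met gives `exists_measure_notMet_le`.

Moments: each coordinate of the estimator is dominated by `|f(Y_k)|` plus the series of
`|f(Y_{n+1})| + |f(Z_n)|` restricted to `notMet n` (`ofReal_abs_joaEstimator_le`). As `Z_t` and
`Y_t` have the same law, these terms have uniformly bounded moments of order `p > l`. Truncating the
`n`-th term at a geometrically growing level trades the surplus `p - l` against the tail
(`lintegral_tsum_indicator_rpow_lt_top`). -/

/-! ### Moments of series of variables supported on rare events. -/

section MomentBounds

lemma ENNReal.add_rpow_le_two_rpow_mul {q : ℝ} (hq : 0 ≤ q) (a b : ℝ≥0∞) :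
    (a + b) ^ q ≤ 2 ^ q * (a ^ q + b ^ q) := by
  have h : a + b ≤ 2 * max a b := by
    rw [two_mul]
    exact add_le_add (le_max_left _ _) (le_max_right _ _)
  calc (a + b) ^ q ≤ (2 * max a b) ^ q := ENNReal.rpow_le_rpow h hq
    _ = 2 ^ q * (max a b) ^ q := ENNReal.mul_rpow_of_nonneg _ _ hq
    _ ≤ 2 ^ q * (a ^ q + b ^ q) := by
      gcongr
      rcases max_cases a b with ⟨h, -⟩ | ⟨h, -⟩ <;> rw [h]
      · exact le_self_add
      · exact le_add_self

/-- A weighted substitute, valid for every `l > 0`, for the triangle inequality in `L^l`. -/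
lemma ENNReal.tsum_rpow_le_weighted {l : ℝ} (hl : 0 < l) {r : ℝ≥0∞} (hr0 : r ≠ 0) (hr : r ≠ ∞)
    (a : ℕ → ℝ≥0∞) :
    (∑' j, a j) ^ l ≤ (∑' j, r ^ j) ^ l * ∑' j, ((r⁻¹) ^ j * a j) ^ l := by
  set T := ∑' j, ((r⁻¹) ^ j * a j) ^ l
  -- A single weighted term is at most the whole sum `T`; no convexity enters, so `l < 1` is
  -- allowed.
  have hj : ∀ j, a j ≤ r ^ j * T ^ (l⁻¹) := by
    intro j
    have h1 : (r⁻¹) ^ j * a j ≤ T ^ (l⁻¹) := by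
      rw [ENNReal.le_rpow_inv_iff hl]
      exact ENNReal.le_tsum (f := fun j => ((r⁻¹) ^ j * a j) ^ l) j
    calc a j = r ^ j * ((r⁻¹) ^ j * a j) := by
          rw [← mul_assoc, ← mul_pow, ENNReal.mul_inv_cancel hr0 hr, one_pow, one_mul]
      _ ≤ _ := by gcongr
  calc (∑' j, a j) ^ l ≤ (∑' j, r ^ j * T ^ (l⁻¹)) ^ l :=
        ENNReal.rpow_le_rpow (ENNReal.tsum_le_tsum hj) hl.le
    _ = (∑' j, r ^ j) ^ l * T := by
      rw [ENNReal.tsum_mul_right, ENNReal.mul_rpow_of_nonneg _ _ hl.le,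
        ENNReal.rpow_inv_rpow hl.ne']

/-- Truncation at level `M`: above it, `x ^ (l - p) ≤ M ^ (l - p)` because the exponent is negative.
-/
lemma ENNReal.rpow_le_rpow_add_rpow_mul {l p : ℝ} (hl : 0 < l) (hp : l < p) {M : ℝ≥0∞}
    (hM0 : M ≠ 0) (hM : M ≠ ∞) (x : ℝ≥0∞) :
    x ^ l ≤ M ^ l + M ^ (l - p) * x ^ p := by
  rcases le_total x M with h | h
  · exact (ENNReal.rpow_le_rpow h hl.le).trans le_self_add
  · refine le_trans ?_ le_add_self
    have hx0 : x ≠ 0 := fun h0 => hM0 (by simpa [h0] using h)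
    rcases eq_or_ne x ∞ with rfl | hx
    · rw [ENNReal.top_rpow_of_pos (hl.trans hp), ENNReal.mul_top]
      · exact le_top
      · exact (ENNReal.rpow_pos (pos_iff_ne_zero.2 hM0) hM).ne'
    · calc x ^ l = x ^ (l - p) * x ^ p := by
            rw [← ENNReal.rpow_add _ _ hx0 hx]; congr 1; ring
        _ ≤ M ^ (l - p) * x ^ p := by
            gcongr ?_ * _
            rw [← neg_sub p l, ENNReal.rpow_neg, ENNReal.rpow_neg, ENNReal.inv_le_inv]
            exact ENNReal.rpow_le_rpow h (by linarith)

variable {E : Type*} [MeasurableSpace E] {μ : Measure E}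

/-- Plays the role of Hölder's inequality, with `M` left free to balance the two terms. -/
lemma lintegral_indicator_rpow_le {l p : ℝ} (hl : 0 < l) (hp : l < p) {M : ℝ≥0∞}
    (hM0 : M ≠ 0) (hM : M ≠ ∞) {A : Set E} (hA : MeasurableSet A) {X : E → ℝ≥0∞}
    (hX : Measurable X) :
    ∫⁻ ω, (A.indicator X ω) ^ l ∂μ ≤ M ^ l * μ A + M ^ (l - p) * ∫⁻ ω, X ω ^ p ∂μ := by
  calc ∫⁻ ω, (A.indicator X ω) ^ l ∂μ
      ≤ ∫⁻ ω, (A.indicator (fun _ => M ^ l) ω + M ^ (l - p) * X ω ^ p) ∂μ := by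
        refine lintegral_mono fun ω => ?_
        by_cases h : ω ∈ A
        · simpa [h] using ENNReal.rpow_le_rpow_add_rpow_mul hl hp hM0 hM (X ω)
        · simp [h, hl]
    _ = _ := by
        rw [lintegral_add_left (measurable_const.indicator hA), lintegral_indicator_const hA,
          lintegral_const_mul _ (hX.pow_const p)]

/-- If the events `A j` have geometrically small probabilities and the variables `X j` have
uniformly bounded moments of order `p > l`, then `∑ⱼ X j 1_{A j}` has a finite moment of
order `l`. -/
lemma lintegral_tsum_indicator_rpow_lt_top {l p : ℝ} (hl : 0 < l) (hp : l < p)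
    {A : ℕ → Set E} (hA : ∀ j, MeasurableSet (A j)) {X : ℕ → E → ℝ≥0∞}
    (hX : ∀ j, Measurable (X j)) {δ : ℝ} (hδ0 : 0 < δ) (hδ1 : δ < 1) {K D : ℝ≥0∞}
    (hK : K ≠ ∞) (hD : D ≠ ∞) (hμ : ∀ j, μ (A j) ≤ K * ENNReal.ofReal δ ^ j)
    (hXp : ∀ j, ∫⁻ ω, X j ω ^ p ∂μ ≤ D) :
    ∫⁻ ω, (∑' j, (A j).indicator (X j) ω) ^ l ∂μ < ∞ := by
  have hp0 : 0 < p := hl.trans hp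
  set d : ℝ≥0∞ := ENNReal.ofReal δ
  have hd0 : d ≠ 0 := by simpa [d] using hδ0
  have hd : d ≠ ∞ := ENNReal.ofReal_ne_top
  have hd1 : d < 1 := by simpa [d] using hδ1
  -- the weights are `r ^ j` and the truncation levels `s ^ (-j)`, with `s = δ ^ (1 / p)`
  set r : ℝ≥0∞ := d ^ ((p - l) / (2 * l * p)) with hr_def
  have hr1 : r < 1 := ENNReal.rpow_lt_one hd1 (by have := sub_pos.2 hp; positivity)
  have hr0 : r ≠ 0 := (ENNReal.rpow_pos (pos_iff_ne_zero.2 hd0) hd).ne'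
  have hr : r ≠ ∞ := hr1.ne_top
  -- The truncation level makes `M ^ l * d ^ j` and `M ^ (l - p)` both equal to `q ^ (2 * j)`. Since
  -- `r ^ l = q`, the weights cost a factor `q ^ (-j)`, and `q ^ j` remains.
  set q : ℝ≥0∞ := d ^ ((p - l) / (2 * p)) with hq_def
  have hq1 : q < 1 := ENNReal.rpow_lt_one hd1 (by have := sub_pos.2 hp; positivity)
  have hterm : ∀ j, ∫⁻ ω, ((r⁻¹) ^ j * (A j).indicator (X j) ω) ^ l ∂μ ≤ (K + D) * q ^ j := by
    intro j
    set M : ℝ≥0∞ := d ^ (-(j : ℝ) / p) with hM_def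
    have hM0 : M ≠ 0 := (ENNReal.rpow_pos (pos_iff_ne_zero.2 hd0) hd).ne'
    have hM : M ≠ ∞ := ENNReal.rpow_ne_top_of_ne_zero hd0 hd
    have hrj : ((r⁻¹) ^ j) ^ l = d ^ (-((p - l) / (2 * p) * j)) := by
      rw [hr_def, ← ENNReal.rpow_neg, ← ENNReal.rpow_natCast, ← ENNReal.rpow_mul,
        ← ENNReal.rpow_mul]
      congr 1
      field_simp
    have hqj : q ^ j = d ^ ((p - l) / (2 * p) * j) := by
      rw [hq_def, ← ENNReal.rpow_natCast, ← ENNReal.rpow_mul]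
    have e1 : ((r⁻¹) ^ j) ^ l * (M ^ l * d ^ j) = q ^ j := by
      rw [hrj, hqj, hM_def, ← ENNReal.rpow_mul, ← ENNReal.rpow_natCast d j,
        ← ENNReal.rpow_add _ _ hd0 hd, ← ENNReal.rpow_add _ _ hd0 hd]
      congr 1
      field_simp
      ring
    have e2 : ((r⁻¹) ^ j) ^ l * M ^ (l - p) = q ^ j := by
      rw [hrj, hqj, hM_def, ← ENNReal.rpow_mul, ← ENNReal.rpow_add _ _ hd0 hd]
      congr 1
      field_simp
      ring
    calc ∫⁻ ω, ((r⁻¹) ^ j * (A j).indicator (X j) ω) ^ l ∂μ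
        = ((r⁻¹) ^ j) ^ l * ∫⁻ ω, ((A j).indicator (X j) ω) ^ l ∂μ := by
          rw [← lintegral_const_mul _ (((hX j).indicator (hA j)).pow_const l)]
          simp_rw [ENNReal.mul_rpow_of_nonneg _ _ hl.le]
      _ ≤ ((r⁻¹) ^ j) ^ l * (M ^ l * (K * d ^ j) + M ^ (l - p) * D) := by
          gcongr
          refine (lintegral_indicator_rpow_le hl hp hM0 hM (hA j) (hX j)).trans ?_
          gcongr
          · exact hμ j
          · exact hXp j
      _ = (((r⁻¹) ^ j) ^ l * (M ^ l * d ^ j)) * K + (((r⁻¹) ^ j) ^ l * M ^ (l - p)) * D := by ring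
      _ = (K + D) * q ^ j := by rw [e1, e2]; ring
  have hgeom : ∀ x : ℝ≥0∞, x < 1 → ∑' j : ℕ, x ^ j ≠ ∞ := fun x hx => by
    rw [ENNReal.tsum_geometric]
    exact ENNReal.inv_ne_top.2 (tsub_pos_of_lt hx).ne'
  have hmeas : ∀ j, Measurable fun ω => ((r⁻¹) ^ j * (A j).indicator (X j) ω) ^ l := fun j =>
    (((hX j).indicator (hA j)).const_mul _).pow_const l
  calc ∫⁻ ω, (∑' j, (A j).indicator (X j) ω) ^ l ∂μ
      ≤ ∫⁻ ω, (∑' j, r ^ j) ^ l * ∑' j, ((r⁻¹) ^ j * (A j).indicator (X j) ω) ^ l ∂μ :=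
        lintegral_mono fun ω => ENNReal.tsum_rpow_le_weighted hl hr0 hr _
    _ = (∑' j, r ^ j) ^ l * ∑' j, ∫⁻ ω, ((r⁻¹) ^ j * (A j).indicator (X j) ω) ^ l ∂μ := by
        rw [lintegral_const_mul _ (Measurable.tsum hmeas),
          lintegral_tsum fun j => (hmeas j).aemeasurable]
    _ ≤ (∑' j, r ^ j) ^ l * ∑' j, (K + D) * q ^ j := by
        gcongr with j
        exact hterm j
    _ < ∞ := by
        rw [ENNReal.tsum_mul_left]
        exact ENNReal.mul_lt_top
          (ENNReal.rpow_lt_top_of_nonneg hl.le (hgeom r hr1))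
          (ENNReal.mul_lt_top (ENNReal.add_lt_top.2 ⟨hK.lt_top, hD.lt_top⟩) (hgeom q hq1).lt_top)

end MomentBounds

/-! ### Contraction of the coupled kernel killed on the diagonal. -/

section CoupledDrift

variable {Ω : Type*} [MeasurableSpace Ω] {P : Kernel Ω Ω} {Pbar : Kernel (Ω × Ω) (Ω × Ω)}

lemma IsKernelCoupling.map_fst (h : IsKernelCoupling P Pbar) (x y : Ω) :
    (Pbar (x, y)).map Prod.fst = P x := by
  ext A hA
  rw [Measure.map_apply measurable_fst hA, ← (h x y A hA).1, Set.prod_univ]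

lemma IsKernelCoupling.map_snd (h : IsKernelCoupling P Pbar) (x y : Ω) :
    (Pbar (x, y)).map Prod.snd = P y := by
  ext A hA
  rw [Measure.map_apply measurable_snd hA, ← (h x y A hA).2, Set.univ_prod]

/-- The drift of `P` towards a sublevel set of `V`, together with a uniform meeting probability on
that set, makes `V x + V y + c` contract under the coupled kernel killed on the diagonal. -/
lemma IsKernelCoupling.exists_contraction [IsMarkovKernel Pbar] (hPbar : IsKernelCoupling P Pbar)
    (hdiagMeas : MeasurableSet (Set.diagonal Ω))
    {V : Ω → ℝ} (hV : Measurable V) (hV1 : ∀ x, 1 ≤ V x) {lam b L : ℝ}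
    (hlam0 : 0 < lam) (hlam1 : lam < 1)
    (hdrift : ∀ x, ∫⁻ y, ENNReal.ofReal (V y) ∂(P x) ≤
      ENNReal.ofReal (lam * V x + {x | V x ≤ L}.indicator (fun _ => b) x))
    (hL : lam + b / (1 + L) < 1) {ε : ℝ} (hε : 0 < ε) (hε1 : ε < 1)
    (hdiag : ∀ x ∈ {x | V x ≤ L}, ∀ y ∈ {x | V x ≤ L},
      ENNReal.ofReal ε ≤ Pbar (x, y) (Set.diagonal Ω)) :
    ∃ c : ℝ, 0 ≤ c ∧ ∃ ρ : ℝ, 0 < ρ ∧ ρ < 1 ∧ ∀ x y,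
      ∫⁻ z, (Set.diagonal Ω)ᶜ.indicator (fun z => ENNReal.ofReal (V z.1 + V z.2 + c)) z
        ∂(Pbar (x, y)) ≤ ENNReal.ofReal ρ * ENNReal.ofReal (V x + V y + c) := by
  -- `b` may be negative; `β` keeps the bounds nonnegative, so that `ENNReal.ofReal` is additive on
  -- them.
  set β : ℝ := max b 0 with hβ
  have hβ0 : 0 ≤ β := le_max_right _ _
  -- Only the constant `c` benefits from the killing; the `V` terms are integrated over the whole
  -- space, where the marginals of the coupling suffice.
  have hint : ∀ x y (c θ : ℝ), 0 ≤ c → 0 ≤ θ →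
      Pbar (x, y) (Set.diagonal Ω)ᶜ ≤ ENNReal.ofReal θ →
      ∫⁻ z, (Set.diagonal Ω)ᶜ.indicator (fun z => ENNReal.ofReal (V z.1 + V z.2 + c)) z
        ∂(Pbar (x, y)) ≤
      ENNReal.ofReal ((lam * V x + {x | V x ≤ L}.indicator (fun _ => β) x) +
        (lam * V y + {x | V x ≤ L}.indicator (fun _ => β) y) + c * θ) := by
    intro x y c θ hc hθ hle
    have hVpos : ∀ x, 0 ≤ V x := fun x => zero_le_one.trans (hV1 x)
    have hpos : ∀ x, 0 ≤ lam * V x + {x | V x ≤ L}.indicator (fun _ => β) x := fun x =>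
      add_nonneg (mul_nonneg hlam0.le (hVpos x)) (Set.indicator_nonneg (fun _ _ => hβ0) x)
    have hd : ∀ x, ∫⁻ y, ENNReal.ofReal (V y) ∂(P x) ≤
        ENNReal.ofReal (lam * V x + {x | V x ≤ L}.indicator (fun _ => β) x) := fun x =>
      (hdrift x).trans <| ENNReal.ofReal_le_ofReal <| by
        gcongr
        exact le_max_left _ _
    have h1 : ∫⁻ z, ENNReal.ofReal (V z.1) ∂(Pbar (x, y)) = ∫⁻ y, ENNReal.ofReal (V y) ∂(P x) := by
      rw [← hPbar.map_fst x y, lintegral_map hV.ennreal_ofReal measurable_fst]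
    have h2 : ∫⁻ z, ENNReal.ofReal (V z.2) ∂(Pbar (x, y)) = ∫⁻ y, ENNReal.ofReal (V y) ∂(P y) := by
      rw [← hPbar.map_snd x y, lintegral_map hV.ennreal_ofReal measurable_snd]
    calc ∫⁻ z, (Set.diagonal Ω)ᶜ.indicator (fun z => ENNReal.ofReal (V z.1 + V z.2 + c)) z
          ∂(Pbar (x, y))
        ≤ ∫⁻ z, (ENNReal.ofReal (V z.1) + ENNReal.ofReal (V z.2) +
            (Set.diagonal Ω)ᶜ.indicator (fun _ => ENNReal.ofReal c) z) ∂(Pbar (x, y)) := by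
          refine lintegral_mono fun z => ?_
          by_cases hz : z ∈ (Set.diagonal Ω)ᶜ
          · simp only [Set.indicator_of_mem hz]
            rw [ENNReal.ofReal_add (add_nonneg (hVpos _) (hVpos _)) hc,
              ENNReal.ofReal_add (hVpos _) (hVpos _)]
          · simp only [Set.indicator_of_notMem hz]
            exact zero_le
      _ = ∫⁻ y, ENNReal.ofReal (V y) ∂(P x) + ∫⁻ z, ENNReal.ofReal (V z) ∂(P y) +
            ENNReal.ofReal c * Pbar (x, y) (Set.diagonal Ω)ᶜ := by
          rw [lintegral_add_right _ (measurable_const.indicator hdiagMeas.compl),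
            lintegral_add_left (f := fun z : Ω × Ω => ENNReal.ofReal (V z.1))
              (hV.comp measurable_fst).ennreal_ofReal, h1, h2,
            lintegral_indicator_const hdiagMeas.compl]
      _ ≤ _ := by
          rw [ENNReal.ofReal_add (add_nonneg (hpos x) (hpos y)) (mul_nonneg hc hθ),
            ENNReal.ofReal_add (hpos x) (hpos y), ENNReal.ofReal_mul hc]
          gcongr
          · exact hd x
          · exact hd y
  -- the contraction rate of `V x + V y` when one of the points is outside the sublevel set
  obtain ⟨κ, hκ0, hκ1, hκ⟩ : ∃ κ : ℝ, 0 < κ ∧ κ < 1 ∧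
      ∀ x y, ¬ (V x ≤ L ∧ V y ≤ L) →
        (lam * V x + {x | V x ≤ L}.indicator (fun _ => β) x) +
        (lam * V y + {x | V x ≤ L}.indicator (fun _ => β) y) ≤ κ * (V x + V y) := by
    -- If `1 + L ≤ 0`, the quotient `b / (1 + L)` is of no use, but the sublevel set is empty since
    -- `V ≥ 1`.
    rcases le_or_gt (1 + L) 0 with h | h
    · refine ⟨lam, hlam0, hlam1, fun x y _ => ?_⟩
      have hn : ∀ x, x ∉ {x | V x ≤ L} := fun x hx => by
        have := hV1 x; simp only [Set.mem_ofPred_eq] at hx; linarith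
      rw [Set.indicator_of_notMem (hn x), Set.indicator_of_notMem (hn y)]
      linarith
    -- At most one point contributes `β`, and then the other exceeds `L`, so `V x + V y ≥ 1 + L`.
    · refine ⟨lam + β / (1 + L), by positivity, ?_, fun x y hxy => ?_⟩
      · rcases max_cases b 0 with ⟨h', -⟩ | ⟨h', -⟩
        · rwa [hβ, h']
        · rw [hβ, h']; simpa using hlam1
      · have hβV : 1 + L ≤ V x + V y → β ≤ β / (1 + L) * (V x + V y) := fun hV => by
          rw [div_mul_eq_mul_div, le_div_iff₀ h]
          gcongr
        have hge : 0 ≤ β / (1 + L) * (V x + V y) :=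
          mul_nonneg (by positivity) (by linarith [hV1 x, hV1 y])
        by_cases hx : V x ≤ L <;> by_cases hy : V y ≤ L
        · exact absurd ⟨hx, hy⟩ hxy
        · have := hβV (by linarith [hV1 x])
          simp [hx, hy]; linarith
        · have := hβV (by linarith [hV1 y])
          simp [hx, hy]; linarith
        · simp [hx, hy]; linarith
  set B : ℝ := max (2 * (lam * L + β)) 0
  have hB : 2 * (lam * L + β) ≤ B := le_max_left _ _
  have hB0 : 0 ≤ B := le_max_right _ _
  -- When both points are in the sublevel set, `B` bounds the drift terms and `B + c * (1 - ε) = (1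
  -- - ε / 2) * c`.
  set c : ℝ := 2 * B / ε with hc_def
  have hc0 : 0 ≤ c := by positivity
  have hcε : c * ε = 2 * B := by rw [hc_def]; field_simp
  -- The second rate serves the remaining pairs: `(κ * W + c) / (W + c)` decreases in `W = V x + V
  -- y`, so its value at `W = 1` bounds it.
  set ρ : ℝ := max (1 - ε / 2) ((κ + c) / (1 + c))
  have hρ1 : 1 - ε / 2 ≤ ρ := le_max_left _ _
  have hρ2 : κ + c ≤ ρ * (1 + c) := (div_le_iff₀ (by positivity)).1 (le_max_right _ _)
  have hρ0 : 0 < ρ := by linarith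
  refine ⟨c, hc0, ρ, hρ0, max_lt (by linarith) ((div_lt_one (by positivity)).2 (by linarith)),
    fun x y => ?_⟩
  rw [← ENNReal.ofReal_mul hρ0.le]
  by_cases hxy : V x ≤ L ∧ V y ≤ L
  · have hprob : Pbar (x, y) (Set.diagonal Ω)ᶜ ≤ ENNReal.ofReal (1 - ε) := by
      rw [prob_compl_eq_one_sub hdiagMeas, ENNReal.ofReal_sub _ hε.le, ENNReal.ofReal_one]
      exact tsub_le_tsub_left (hdiag x hxy.1 y hxy.2) 1
    refine (hint x y c (1 - ε) hc0 (by linarith) hprob).trans (ENNReal.ofReal_le_ofReal ?_)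
    rw [Set.indicator_of_mem (show x ∈ {x | V x ≤ L} from hxy.1),
      Set.indicator_of_mem (show y ∈ {x | V x ≤ L} from hxy.2)]
    have h1 := mul_le_mul_of_nonneg_left hxy.1 hlam0.le
    have h2 := mul_le_mul_of_nonneg_left hxy.2 hlam0.le
    have h3 : (1 - ε / 2) * c ≤ ρ * c := by gcongr
    have h4 : 0 ≤ ρ * (V x + V y) := mul_nonneg hρ0.le (by linarith [hV1 x, hV1 y])
    nlinarith
  · refine (hint x y c 1 hc0 zero_le_one (by simpa using prob_le_one)).trans
      (ENNReal.ofReal_le_ofReal ?_)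
    have h1 := hκ x y hxy
    have hW : 1 ≤ V x + V y := by linarith [hV1 x, hV1 y]
    have hρκ : 0 ≤ ρ - κ := by nlinarith [le_max_right (1 - ε / 2) ((κ + c) / (1 + c))]
    nlinarith [mul_le_mul_of_nonneg_left hW hρκ]

end CoupledDrift

/-! ### The events of not having met. -/

section MeetingTime

variable {Ω E : Type*}

/-- The event that `Y` and the lagged chain `Z` have not met by time `n + 1`. -/
def notMet (Y Z : ℕ → E → Ω) (n : ℕ) : Set E :=
  {ω | ∀ i ≤ n, Y (i + 1) ω ≠ Z i ω}

lemma mem_notMet_of_lt_meetingTime {Y Z : ℕ → E → Ω} {n : ℕ} {ω : E}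
    (h : ((n + 1 : ℕ) : ℕ∞) < meetingTime Y Z ω) : ω ∈ notMet Y Z n := by
  intro i hi heq
  refine absurd h (not_lt.2 ?_)
  refine (iInf₂_le (i + 1) ⟨by omega, by simpa using heq⟩).trans ?_
  exact_mod_cast Nat.succ_le_succ hi

lemma notMet_succ (Y Z : ℕ → E → Ω) (n : ℕ) :
    notMet Y Z (n + 1) =
      notMet Y Z n ∩ {ω | (Y (n + 2) ω, Z (n + 1) ω) ∈ (Set.diagonal Ω)ᶜ} := by
  ext ω
  simp only [notMet, Set.mem_ofPred_eq, Set.mem_inter_iff, Set.mem_compl_iff, Set.mem_diagonal_iff]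
  constructor
  · exact fun h => ⟨fun i hi => h i (by omega), h (n + 1) le_rfl⟩
  · rintro ⟨h1, h2⟩ i hi
    rcases Nat.lt_or_ge n i with h | h
    · obtain rfl : i = n + 1 := by omega
      exact h2
    · exact h1 i h

variable [MeasurableSpace Ω]

/-- The event involves only `Y_1, …, Y_{n+1}` and `Z_0, …, Z_n`, so the Markov property can be
applied on it. -/
lemma measurableSet_notMet_coupledHistory (hdiagMeas : MeasurableSet (Set.diagonal Ω))
    (Y Z : ℕ → E → Ω) (n : ℕ) : MeasurableSet[coupledHistory Y Z n] (notMet Y Z n) := by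
  have hY : ∀ i ≤ n, Measurable[coupledHistory Y Z n] (Y (i + 1)) := fun i hi =>
    Measurable.of_comap_le <| le_sup_of_le_left <|
      le_iSup₂_of_le (i + 1) (Set.mem_Iic.2 (by omega)) le_rfl
  have hZ : ∀ i ≤ n, Measurable[coupledHistory Y Z n] (Z i) := fun i hi =>
    Measurable.of_comap_le <| le_sup_of_le_right <|
      le_iSup₂_of_le i (Set.mem_Iic.2 hi) le_rfl
  have : notMet Y Z n = ⋂ i ∈ Set.Iic n, (fun ω => (Y (i + 1) ω, Z i ω)) ⁻¹' (Set.diagonal Ω)ᶜ := by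
    ext ω; simp [notMet]
  rw [this]
  refine @MeasurableSet.biInter _ _ (coupledHistory Y Z n) _ _ (Set.to_countable _) fun i hi => ?_
  exact measurableSet_preimage ((hY i hi).prodMk (hZ i hi)) hdiagMeas.compl

end MeetingTime

/-! ### Laws of the coupled chains and geometric tails. -/

namespace IsLaggedCoupledChain

variable {Ω E : Type*} [MeasurableSpace Ω] [MeasurableSpace E] {μ : Measure E} {π₀ : Measure Ω}
  {P : Kernel Ω Ω} {Pbar : Kernel (Ω × Ω) (Ω × Ω)} {Y Z : ℕ → E → Ω}

lemma coupledHistory_le (h : IsLaggedCoupledChain μ π₀ P Pbar Y Z) (n : ℕ) :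
    coupledHistory Y Z n ≤ (inferInstance : MeasurableSpace E) :=
  sup_le (iSup₂_le fun i _ => (h.measurable_Y i).comap_le)
    (iSup₂_le fun i _ => (h.measurable_Z i).comap_le)

lemma measurableSet_notMet (h : IsLaggedCoupledChain μ π₀ P Pbar Y Z)
    (hdiagMeas : MeasurableSet (Set.diagonal Ω)) (n : ℕ) : MeasurableSet (notMet Y Z n) :=
  h.coupledHistory_le n _ (measurableSet_notMet_coupledHistory hdiagMeas Y Z n)

lemma measurable_pair (h : IsLaggedCoupledChain μ π₀ P Pbar Y Z) (n : ℕ) :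
    Measurable fun ω => (Y (n + 1) ω, Z n ω) :=
  (h.measurable_Y _).prodMk (h.measurable_Z _)

/-- The Markov property says that, under `μ` restricted to `A`, the law of the next pair is the
current one pushed through `Pbar`; integrating `g` against both sides suffices. -/
lemma setLIntegral_succ (h : IsLaggedCoupledChain μ π₀ P Pbar Y Z) (n : ℕ) {A : Set E}
    (hA : MeasurableSet[coupledHistory Y Z n] A) {g : Ω × Ω → ℝ≥0∞} (hg : Measurable g) :
    ∫⁻ ω in A, g (Y (n + 2) ω, Z (n + 1) ω) ∂μ =
      ∫⁻ ω in A, ∫⁻ z, g z ∂(Pbar (Y (n + 1) ω, Z n ω)) ∂μ := by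
  have hlaw : (μ.restrict A).map (fun ω => (Y (n + 2) ω, Z (n + 1) ω)) =
      ((μ.restrict A).map (fun ω => (Y (n + 1) ω, Z n ω))).bind Pbar := by
    ext C hC
    rw [Measure.map_apply (h.measurable_pair (n + 1)) hC,
      Measure.restrict_apply (h.measurable_pair (n + 1) hC),
      Measure.bind_apply hC Pbar.measurable.aemeasurable,
      lintegral_map (Pbar.measurable_coe hC) (h.measurable_pair n), Set.inter_comm]
    exact h.markov n A hA C hC
  rw [← lintegral_map hg (h.measurable_pair (n + 1)), hlaw,
    Measure.lintegral_bind Pbar.measurable.aemeasurable hg.aemeasurable,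
    lintegral_map hg.lintegral_kernel (h.measurable_pair n)]

lemma map_Y_succ_succ (h : IsLaggedCoupledChain μ π₀ P Pbar Y Z) (hPbar : IsKernelCoupling P Pbar)
    (n : ℕ) : μ.map (Y (n + 2)) = (μ.map (Y (n + 1))).bind P := by
  ext A hA
  rw [Measure.map_apply (h.measurable_Y _) hA, Measure.bind_apply hA P.measurable.aemeasurable,
    lintegral_map (P.measurable_coe hA) (h.measurable_Y _)]
  have := h.markov n Set.univ MeasurableSet.univ (A ×ˢ Set.univ) (hA.prod MeasurableSet.univ)
  simpa [(hPbar _ _ A hA).1, Set.preimage] using this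

lemma map_Z_succ (h : IsLaggedCoupledChain μ π₀ P Pbar Y Z) (hPbar : IsKernelCoupling P Pbar)
    (n : ℕ) : μ.map (Z (n + 1)) = (μ.map (Z n)).bind P := by
  ext A hA
  rw [Measure.map_apply (h.measurable_Z _) hA, Measure.bind_apply hA P.measurable.aemeasurable,
    lintegral_map (P.measurable_coe hA) (h.measurable_Z _)]
  have := h.markov n Set.univ MeasurableSet.univ (Set.univ ×ˢ A) (MeasurableSet.univ.prod hA)
  simpa [(hPbar _ _ A hA).2, Set.preimage] using this

/-- A function contracted by the coupled kernel killed on the diagonal controls the tail of the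
meeting time. -/
lemma setLIntegral_notMet_le (h : IsLaggedCoupledChain μ π₀ P Pbar Y Z)
    (hdiagMeas : MeasurableSet (Set.diagonal Ω)) {U : Ω × Ω → ℝ≥0∞} (hU : Measurable U)
    {ρ : ℝ≥0∞} (hρ : ∀ x y, ∫⁻ z, (Set.diagonal Ω)ᶜ.indicator U z ∂(Pbar (x, y)) ≤ ρ * U (x, y))
    (n : ℕ) : ∫⁻ ω in notMet Y Z n, U (Y (n + 1) ω, Z n ω) ∂μ ≤
      (∫⁻ ω, U (Y 1 ω, Z 0 ω) ∂μ) * ρ ^ n := by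
  induction n with
  | zero => simpa using setLIntegral_le_lintegral _ _
  | succ n ih =>
    have hset : MeasurableSet {ω | (Y (n + 2) ω, Z (n + 1) ω) ∈ (Set.diagonal Ω)ᶜ} :=
      h.measurable_pair (n + 1) hdiagMeas.compl
    -- Not meeting at the next step amounts to killing `U` on the diagonal, which leaves a past
    -- event to condition on.
    calc ∫⁻ ω in notMet Y Z (n + 1), U (Y (n + 2) ω, Z (n + 1) ω) ∂μ
        = ∫⁻ ω in notMet Y Z n,
            (Set.diagonal Ω)ᶜ.indicator U (Y (n + 2) ω, Z (n + 1) ω) ∂μ := by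
          rw [notMet_succ, Set.inter_comm, ← setLIntegral_indicator hset]
          rfl
      _ = ∫⁻ ω in notMet Y Z n,
            ∫⁻ z, (Set.diagonal Ω)ᶜ.indicator U z ∂(Pbar (Y (n + 1) ω, Z n ω)) ∂μ :=
          h.setLIntegral_succ n (measurableSet_notMet_coupledHistory hdiagMeas Y Z n)
            (hU.indicator hdiagMeas.compl)
      _ ≤ ∫⁻ ω in notMet Y Z n, ρ * U (Y (n + 1) ω, Z n ω) ∂μ :=
          lintegral_mono fun ω => hρ _ _
      _ = ρ * ∫⁻ ω in notMet Y Z n, U (Y (n + 1) ω, Z n ω) ∂μ :=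
          lintegral_const_mul _ (hU.comp (h.measurable_pair n))
      _ ≤ ρ * ((∫⁻ ω, U (Y 1 ω, Z 0 ω) ∂μ) * ρ ^ n) := by gcongr
      _ = _ := by rw [pow_succ]; ring

variable [IsProbabilityMeasure π₀]

lemma map_Y_zero_one (h : IsLaggedCoupledChain μ π₀ P Pbar Y Z) :
    μ.map (fun ω => (Y 0 ω, Y 1 ω)) = π₀ ⊗ₘ P := by
  have hm : Measurable fun ω => ((Y 0 ω, Y 1 ω), Z 0 ω) :=
    ((h.measurable_Y 0).prodMk (h.measurable_Y 1)).prodMk (h.measurable_Z 0)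
  have := congrArg (Measure.map Prod.fst) h.initial
  rwa [Measure.map_map measurable_fst hm, Measure.map_fst_prod, measure_univ, one_smul] at this

variable [IsMarkovKernel P]

lemma map_Z_zero (h : IsLaggedCoupledChain μ π₀ P Pbar Y Z) : μ.map (Z 0) = π₀ := by
  have hm : Measurable fun ω => ((Y 0 ω, Y 1 ω), Z 0 ω) :=
    ((h.measurable_Y 0).prodMk (h.measurable_Y 1)).prodMk (h.measurable_Z 0)
  have := congrArg (Measure.map Prod.snd) h.initial
  rwa [Measure.map_map measurable_snd hm, Measure.map_snd_prod, measure_univ, one_smul] at this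

lemma map_Y_zero (h : IsLaggedCoupledChain μ π₀ P Pbar Y Z) : μ.map (Y 0) = π₀ := by
  have hm : Measurable fun ω => (Y 0 ω, Y 1 ω) := (h.measurable_Y 0).prodMk (h.measurable_Y 1)
  have := congrArg (Measure.map Prod.fst) h.map_Y_zero_one
  rw [Measure.map_map measurable_fst hm] at this
  exact this.trans (Measure.fst_compProd π₀ P)

lemma map_Y_one (h : IsLaggedCoupledChain μ π₀ P Pbar Y Z) : μ.map (Y 1) = π₀.bind P := by
  have hm : Measurable fun ω => (Y 0 ω, Y 1 ω) := (h.measurable_Y 0).prodMk (h.measurable_Y 1)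
  have := congrArg (Measure.map Prod.snd) h.map_Y_zero_one
  rw [Measure.map_map measurable_snd hm] at this
  exact this.trans (Measure.snd_compProd π₀ P)

/-- Both chains start from `π₀` and evolve by `P`; this transfers the moment bounds from `Y` to `Z`.
The case `1` is separate because `Y_1` is governed by the initial law, not by `Pbar`. -/
lemma map_Z_eq_map_Y (h : IsLaggedCoupledChain μ π₀ P Pbar Y Z) (hPbar : IsKernelCoupling P Pbar) :
    ∀ n, μ.map (Z n) = μ.map (Y n)
  | 0 => h.map_Z_zero.trans h.map_Y_zero.symm
  | 1 => by rw [h.map_Z_succ hPbar, h.map_Z_zero, h.map_Y_one]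
  | n + 2 => by
    rw [h.map_Z_succ hPbar, h.map_Y_succ_succ hPbar, h.map_Z_eq_map_Y hPbar (n + 1)]

/-- The meeting time has geometric tails. -/
lemma exists_measure_notMet_le [IsProbabilityMeasure μ] [IsMarkovKernel Pbar]
    (h : IsLaggedCoupledChain μ π₀ P Pbar Y Z) (hPbar : IsKernelCoupling P Pbar)
    (hdiagMeas : MeasurableSet (Set.diagonal Ω))
    {V : Ω → ℝ} (hV : Measurable V) (hV1 : ∀ x, 1 ≤ V x) {lam b L : ℝ}
    (hlam0 : 0 < lam) (hlam1 : lam < 1)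
    (hdrift : ∀ x, ∫⁻ y, ENNReal.ofReal (V y) ∂(P x) ≤
      ENNReal.ofReal (lam * V x + {x | V x ≤ L}.indicator (fun _ => b) x))
    (hL : lam + b / (1 + L) < 1) (hπ₀ : Integrable V π₀) {ε : ℝ} (hε : 0 < ε) (hε1 : ε < 1)
    (hdiag : ∀ x ∈ {x | V x ≤ L}, ∀ y ∈ {x | V x ≤ L},
      ENNReal.ofReal ε ≤ Pbar (x, y) (Set.diagonal Ω)) :
    ∃ K : ℝ≥0∞, K ≠ ∞ ∧ ∃ ρ : ℝ, 0 < ρ ∧ ρ < 1 ∧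
      ∀ n, μ (notMet Y Z n) ≤ K * ENNReal.ofReal ρ ^ n := by
  obtain ⟨c, hc, ρ, hρ0, hρ1, hρ⟩ := hPbar.exists_contraction hdiagMeas hV hV1 hlam0 hlam1 hdrift
    hL hε hε1 hdiag
  set U : Ω × Ω → ℝ≥0∞ := fun z => ENNReal.ofReal (V z.1 + V z.2 + c) with hU_def
  have hU : Measurable U :=
    (((hV.comp measurable_fst).add (hV.comp measurable_snd)).add_const c).ennreal_ofReal
  have hVpos : ∀ x, 0 ≤ V x := fun x => zero_le_one.trans (hV1 x)
  -- This is finite because `Z_0` has law `π₀` and `Y_1` is one drift step away from it. The tail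
  -- bound follows from `U ≥ 1`.
  refine ⟨∫⁻ ω, U (Y 1 ω, Z 0 ω) ∂μ, ?_, ρ, hρ0, hρ1, fun n => ?_⟩
  · have hπV : ∫⁻ x, ENNReal.ofReal (V x) ∂π₀ < ∞ := hπ₀.lintegral_lt_top
    have hZ : ∫⁻ ω, ENNReal.ofReal (V (Z 0 ω)) ∂μ < ∞ := by
      rwa [← lintegral_map hV.ennreal_ofReal (h.measurable_Z 0), h.map_Z_zero]
    have hY : ∫⁻ ω, ENNReal.ofReal (V (Y 1 ω)) ∂μ < ∞ := by
      rw [← lintegral_map hV.ennreal_ofReal (h.measurable_Y 1), h.map_Y_one,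
        Measure.lintegral_bind P.measurable.aemeasurable hV.ennreal_ofReal.aemeasurable]
      calc ∫⁻ x, ∫⁻ y, ENNReal.ofReal (V y) ∂(P x) ∂π₀
          ≤ ∫⁻ x, (ENNReal.ofReal (V x) + ENNReal.ofReal |b|) ∂π₀ := by
            refine lintegral_mono fun x => (hdrift x).trans ?_
            rw [← ENNReal.ofReal_add (hVpos x) (abs_nonneg b)]
            refine ENNReal.ofReal_le_ofReal (add_le_add ?_ ?_)
            · exact mul_le_of_le_one_left (hVpos x) hlam1.le
            · exact Set.indicator_apply_le' (fun _ => le_abs_self b) (fun _ => abs_nonneg b)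
        _ < ∞ := by
            rw [lintegral_add_right _ measurable_const, lintegral_const, measure_univ, mul_one]
            exact ENNReal.add_lt_top.2 ⟨hπV, ENNReal.ofReal_lt_top⟩
    have hsplit : ∀ ω, U (Y 1 ω, Z 0 ω) =
        ENNReal.ofReal (V (Y 1 ω)) + ENNReal.ofReal (V (Z 0 ω)) + ENNReal.ofReal c := fun ω => by
      rw [hU_def]
      simp only
      rw [ENNReal.ofReal_add (add_nonneg (hVpos _) (hVpos _)) hc,
        ENNReal.ofReal_add (hVpos _) (hVpos _)]
    simp_rw [hsplit]
    rw [lintegral_add_right _ measurable_const,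
      lintegral_add_left (f := fun ω => ENNReal.ofReal (V (Y 1 ω)))
        (hV.comp (h.measurable_Y 1)).ennreal_ofReal, lintegral_const,
      measure_univ, mul_one]
    exact (ENNReal.add_lt_top.2 ⟨ENNReal.add_lt_top.2 ⟨hY, hZ⟩, ENNReal.ofReal_lt_top⟩).ne
  · calc μ (notMet Y Z n) = ∫⁻ _ in notMet Y Z n, 1 ∂μ := by simp
      _ ≤ ∫⁻ ω in notMet Y Z n, U (Y (n + 1) ω, Z n ω) ∂μ := by
          refine lintegral_mono fun ω => ?_
          rw [hU_def, ← ENNReal.ofReal_one]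
          exact ENNReal.ofReal_le_ofReal (by simp only; linarith [hV1 (Y (n + 1) ω), hVpos (Z n ω)])
      _ ≤ _ := h.setLIntegral_notMet_le hdiagMeas hU hρ n

end IsLaggedCoupledChain

/-! ### Domination and moments of the estimator. -/

section Estimator

variable {Ω E : Type*}

lemma ae_meetingTime_lt_top [MeasurableSpace E] {μ : Measure E} {Y Z : ℕ → E → Ω} {K : ℝ≥0∞}
    (hK : K ≠ ∞) {ρ : ℝ} (hρ1 : ρ < 1)
    (htail : ∀ n, μ (notMet Y Z n) ≤ K * ENNReal.ofReal ρ ^ n) :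
    ∀ᵐ ω ∂μ, meetingTime Y Z ω < ⊤ := by
  rw [ae_iff]
  have hle : ∀ n, μ {ω | ¬ meetingTime Y Z ω < ⊤} ≤ K * ENNReal.ofReal ρ ^ n := fun n =>
    (measure_mono fun ω hω => mem_notMet_of_lt_meetingTime <| by
      rw [not_lt_top_iff.1 hω]; exact ENat.natCast_lt_top _).trans (htail n)
  have hlim : Filter.Tendsto (fun n : ℕ => K * ENNReal.ofReal ρ ^ n) Filter.atTop (nhds 0) := by
    simpa using ENNReal.Tendsto.const_mul
      (ENNReal.tendsto_pow_atTop_nhds_zero_of_lt_one (by simpa using hρ1)) (Or.inr hK)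
  exact le_antisymm (ge_of_tendsto' hlim hle) zero_le

/-- Indicators replace the random range of summation: the index `j = n + 1` occurs only if `n + 1 <
τ`, which forces `notMet n`. -/
lemma ofReal_abs_joaEstimator_le {m : ℕ} (f : Ω → Fin m → ℝ) (Y Z : ℕ → E → Ω) (k : ℕ) (ω : E)
    (i : Fin m) :
    ENNReal.ofReal |joaEstimator f Y Z k ω i| ≤ ENNReal.ofReal |f (Y k ω) i| +
      ∑' n, (notMet Y Z n).indicator
        (fun ω => ENNReal.ofReal |f (Y (n + 1) ω) i| + ENNReal.ofReal |f (Z n ω) i|) ω := by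
  set g : ℕ → ℝ≥0∞ := fun n => (notMet Y Z n).indicator
    (fun ω => ENNReal.ofReal |f (Y (n + 1) ω) i| + ENNReal.ofReal |f (Z n ω) i|) ω with hg
  unfold joaEstimator
  generalize hN : (meetingTime Y Z ω).toNat = N
  have hterm : ∀ j ∈ Finset.Ico (k + 1) N,
      ENNReal.ofReal |f (Y j ω) i - f (Z (j - 1) ω) i| ≤ g (j - 1) := by
    intro j hj
    obtain ⟨hj1, hj2⟩ := Finset.mem_Ico.1 hj
    obtain ⟨n, rfl⟩ : ∃ n, j = n + 1 := ⟨j - 1, by omega⟩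
    have hmem : ω ∈ notMet Y Z n := by
      -- This also covers `τ = ∞`, where `toNat` is `0` and the sum is empty, so the bound holds for
      -- every `ω`.
      refine mem_notMet_of_lt_meetingTime (lt_of_lt_of_le ?_ (ENat.natCast_toNat_le_self _))
      rw [hN]
      exact_mod_cast hj2
    rw [hg]
    simp only [Nat.add_sub_cancel, Set.indicator_of_mem hmem]
    rw [← ENNReal.ofReal_add (abs_nonneg _) (abs_nonneg _)]
    exact ENNReal.ofReal_le_ofReal (abs_sub _ _)
  have hsum : ∑ j ∈ Finset.Ico (k + 1) N, g (j - 1) ≤ ∑' n, g n := by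
    rcases N with _ | N
    · simp
    · rw [← Finset.sum_Ico_add' (fun j => g (j - 1)) k N 1]
      simpa using ENNReal.sum_le_tsum (f := g) (Finset.Ico k N)
  calc ENNReal.ofReal |(f (Y k ω) + ∑ i ∈ Finset.Ico (k + 1) N, (f (Y i ω) - f (Z (i - 1) ω))) i|
      ≤ ENNReal.ofReal (|f (Y k ω) i| +
          ∑ j ∈ Finset.Ico (k + 1) N, |f (Y j ω) i - f (Z (j - 1) ω) i|) := by
        refine ENNReal.ofReal_le_ofReal ?_
        simp only [Pi.add_apply, Finset.sum_apply, Pi.sub_apply]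
        exact (abs_add_le _ _).trans (by gcongr; exact Finset.abs_sum_le_sum_abs _ _)
    _ = ENNReal.ofReal |f (Y k ω) i| +
          ∑ j ∈ Finset.Ico (k + 1) N, ENNReal.ofReal |f (Y j ω) i - f (Z (j - 1) ω) i| := by
        rw [ENNReal.ofReal_add (abs_nonneg _) (Finset.sum_nonneg fun _ _ => abs_nonneg _),
          ENNReal.ofReal_sum_of_nonneg fun _ _ => abs_nonneg _]
    _ ≤ _ := by
        gcongr
        exact (Finset.sum_le_sum hterm).trans hsum

lemma lintegral_ofReal_abs_rpow_le_lqMoment [MeasurableSpace E] {μ : Measure E} {m : ℕ} {q : ℝ}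
    (hq : 0 ≤ q) (X : E → Fin m → ℝ) (i : Fin m) :
    ∫⁻ ω, ENNReal.ofReal |X ω i| ^ q ∂μ ≤ lqMoment μ q X := by
  refine lintegral_mono fun ω => ?_
  rw [ENNReal.ofReal_rpow_of_nonneg (abs_nonneg _) hq]
  exact Finset.single_le_sum (f := fun i => ENNReal.ofReal (|X ω i| ^ q))
    (fun _ _ => zero_le) (Finset.mem_univ i)

lemma lqMoment_joaEstimator_lt_top [MeasurableSpace Ω] [MeasurableSpace E] {μ : Measure E}
    [IsProbabilityMeasure μ] {Y Z : ℕ → E → Ω} (hY : ∀ n, Measurable (Y n))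
    (hZ : ∀ n, Measurable (Z n)) (hmeet : ∀ n, MeasurableSet (notMet Y Z n))
    {K : ℝ≥0∞} (hK : K ≠ ∞) {ρ : ℝ} (hρ0 : 0 < ρ) (hρ1 : ρ < 1)
    (htail : ∀ n, μ (notMet Y Z n) ≤ K * ENNReal.ofReal ρ ^ n)
    {m : ℕ} {f : Ω → Fin m → ℝ} (hf : Measurable f) {l p : ℝ} (hl : 0 < l) (hp : l < p)
    {D : ℝ≥0∞} (hD : D ≠ ∞) (hmomY : ∀ t, lqMoment μ p (fun ω => f (Y t ω)) ≤ D)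
    (hmomZ : ∀ t, lqMoment μ p (fun ω => f (Z t ω)) ≤ D) (k : ℕ) :
    lqMoment μ l (joaEstimator f Y Z k) < ∞ := by
  have hp0 : 0 < p := hl.trans hp
  have hmeas : ∀ {W : E → Ω}, Measurable W → ∀ i, Measurable fun ω => ENNReal.ofReal |f (W ω) i| :=
    fun hW i => (((measurable_pi_apply i).comp (hf.comp hW)).abs).ennreal_ofReal
  set S : Fin m → E → ℝ≥0∞ := fun i ω => ∑' n, (notMet Y Z n).indicator
    (fun ω => ENNReal.ofReal |f (Y (n + 1) ω) i| + ENNReal.ofReal |f (Z n ω) i|) ω with hS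
  have hSmeas : ∀ i, Measurable (S i) := fun i => Measurable.tsum fun n =>
    ((hmeas (hY _) i).add (hmeas (hZ _) i)).indicator (hmeet n)
  have hSfin : ∀ i, ∫⁻ ω, S i ω ^ l ∂μ < ∞ := by
    intro i
    refine lintegral_tsum_indicator_rpow_lt_top hl hp hmeet
      (fun n => (hmeas (hY _) i).add (hmeas (hZ _) i)) hρ0 hρ1 hK (D := 2 ^ p * (D + D))
      ?_ htail fun n => ?_
    · exact ENNReal.mul_ne_top (ENNReal.rpow_ne_top_of_nonneg hp0.le (by simp))
        (ENNReal.add_ne_top.2 ⟨hD, hD⟩)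
    · calc ∫⁻ ω, (ENNReal.ofReal |f (Y (n + 1) ω) i| + ENNReal.ofReal |f (Z n ω) i|) ^ p ∂μ
          ≤ ∫⁻ ω, 2 ^ p * (ENNReal.ofReal |f (Y (n + 1) ω) i| ^ p +
              ENNReal.ofReal |f (Z n ω) i| ^ p) ∂μ :=
            lintegral_mono fun ω => ENNReal.add_rpow_le_two_rpow_mul hp0.le _ _
        _ = 2 ^ p * (∫⁻ ω, ENNReal.ofReal |f (Y (n + 1) ω) i| ^ p ∂μ +
              ∫⁻ ω, ENNReal.ofReal |f (Z n ω) i| ^ p ∂μ) := by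
            rw [lintegral_const_mul' _ _ (ENNReal.rpow_ne_top_of_nonneg hp0.le (by simp)),
              lintegral_add_left ((hmeas (hY _) i).pow_const p)]
        _ ≤ 2 ^ p * (D + D) := by
            gcongr
            · exact (lintegral_ofReal_abs_rpow_le_lqMoment hp0.le (fun ω => f (Y (n + 1) ω)) i).trans
                (hmomY _)
            · exact (lintegral_ofReal_abs_rpow_le_lqMoment hp0.le (fun ω => f (Z n ω)) i).trans
                (hmomZ _)
  have hFfin : ∀ i, ∫⁻ ω, ENNReal.ofReal |f (Y k ω) i| ^ l ∂μ < ∞ := by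
    intro i
    -- Truncation at level `1` on the whole space: `x ^ l ≤ 1 + x ^ p`.
    have h1 := lintegral_indicator_rpow_le (μ := μ) hl hp one_ne_zero ENNReal.one_ne_top
      MeasurableSet.univ (hmeas (hY k) i)
    simp only [Set.indicator_univ, ENNReal.one_rpow, measure_univ, one_mul] at h1
    refine h1.trans_lt (ENNReal.add_lt_top.2 ⟨ENNReal.one_lt_top, ?_⟩)
    exact ((lintegral_ofReal_abs_rpow_le_lqMoment hp0.le (fun ω => f (Y k ω)) i).trans
      (hmomY k)).trans_lt hD.lt_top
  calc lqMoment μ l (joaEstimator f Y Z k)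
      ≤ ∫⁻ ω, ∑ i, 2 ^ l * (ENNReal.ofReal |f (Y k ω) i| ^ l + S i ω ^ l) ∂μ := by
        refine lintegral_mono fun ω => Finset.sum_le_sum fun i _ => ?_
        rw [← ENNReal.ofReal_rpow_of_nonneg (abs_nonneg _) hl.le]
        exact (ENNReal.rpow_le_rpow (ofReal_abs_joaEstimator_le f Y Z k ω i) hl.le).trans
          (ENNReal.add_rpow_le_two_rpow_mul hl.le _ _)
    _ = ∑ i, 2 ^ l * (∫⁻ ω, ENNReal.ofReal |f (Y k ω) i| ^ l ∂μ + ∫⁻ ω, S i ω ^ l ∂μ) := by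
        have hm : ∀ i, Measurable fun ω => ENNReal.ofReal |f (Y k ω) i| ^ l + S i ω ^ l :=
          fun i => ((hmeas (hY k) i).pow_const l).add ((hSmeas i).pow_const l)
        rw [lintegral_finsetSum _ fun i _ => (hm i).const_mul _]
        refine Finset.sum_congr rfl fun i _ => ?_
        rw [lintegral_const_mul _ (hm i), lintegral_add_left ((hmeas (hY k) i).pow_const l)]
    _ < ∞ := ENNReal.sum_lt_top.2 fun i _ =>
        ENNReal.mul_lt_top (ENNReal.rpow_lt_top_of_nonneg hl.le (by simp))
          (ENNReal.add_lt_top.2 ⟨hFfin i, hSfin i⟩)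

end Estimator

/-! ### Assembly of the tail and moment bounds. -/

theorem proposition4
    {Ω : Type*} [TopologicalSpace Ω] [PolishSpace Ω] [MeasurableSpace Ω] [BorelSpace Ω]
    {E : Type*} [MeasurableSpace E] (μ : Measure E) [IsProbabilityMeasure μ]
    (π π₀ : Measure Ω) [IsProbabilityMeasure π] [IsProbabilityMeasure π₀]
    (P : Kernel Ω Ω) [IsMarkovKernel P]
    (Pbar : Kernel (Ω × Ω) (Ω × Ω)) [IsMarkovKernel Pbar]
    (hPbar : IsKernelCoupling P Pbar)
    (Y Z : ℕ → E → Ω)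
    (hchain : IsLaggedCoupledChain μ π₀ P Pbar Y Z)
    (hfaithful : StaysTogether μ Y Z)
    (V : Ω → ℝ) (lam b L : ℝ)
    (hdrift : GeometricDrift P π V lam b {x | V x ≤ L})
    (hsmall : IsSmallSet P {x | V x ≤ L})
    (hL : lam + b / (1 + L) < 1)
    (hπ₀ : Integrable V π₀)
    (ε : ℝ) (hε : 0 < ε) (hε1 : ε < 1)
    (hdiag : ∀ x ∈ {x | V x ≤ L}, ∀ y ∈ {x | V x ≤ L},
      ENNReal.ofReal ε ≤ Pbar (x, y) (Set.diagonal Ω))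
    {m : ℕ} (f : Ω → Fin m → ℝ) (hf : Measurable f)
    (l : ℝ) (hl : 0 < l) (p : ℝ) (hp : l < p) (D : ℝ) (hD : 0 < D)
    (hmom : ∀ t : ℕ, lqMoment μ p (fun ω => f (Y t ω)) < ENNReal.ofReal D) :
    (∀ᵐ ω ∂μ, meetingTime Y Z ω < ⊤) ∧
      ∀ k : ℕ, lqMoment μ l (joaEstimator f Y Z k) < ∞ ∧
        ∀ α : ℝ, 0 < α → 2 + α < l → MomentAssumption μ α (joaEstimator f Y Z k) := by
  -- The Polish hypothesis enters here: the diagonal is closed, and by second countability the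
  -- product `σ`-algebra is the Borel one.
  have hdiagMeas : MeasurableSet (Set.diagonal Ω) := isClosed_diagonal.measurableSet
  obtain ⟨K, hK, ρ, hρ0, hρ1, htail⟩ := hchain.exists_measure_notMet_le hPbar hdiagMeas
    hdrift.measurable_V hdrift.one_le_V hdrift.lam_pos hdrift.lam_lt_one hdrift.drift hL hπ₀ hε hε1
    hdiag
  have hmomZ : ∀ t, lqMoment μ p (fun ω => f (Z t ω)) ≤ ENNReal.ofReal D := by
    intro t
    have hg : Measurable fun x => ∑ i, ENNReal.ofReal (|f x i| ^ p) :=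
      Finset.measurable_fun_sum _ fun i _ =>
        ((((measurable_pi_apply i).comp hf).abs).pow_const p).ennreal_ofReal
    have hlaw : lqMoment μ p (fun ω => f (Z t ω)) = lqMoment μ p (fun ω => f (Y t ω)) := by
      unfold lqMoment
      rw [← lintegral_map hg (hchain.measurable_Z t), hchain.map_Z_eq_map_Y hPbar t,
        lintegral_map hg (hchain.measurable_Y t)]
    exact hlaw.trans_le (hmom t).le
  refine ⟨ae_meetingTime_lt_top hK hρ1 htail, fun k => ?_⟩
  have hfin : lqMoment μ l (joaEstimator f Y Z k) < ∞ :=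
    lqMoment_joaEstimator_lt_top hchain.measurable_Y hchain.measurable_Z
      (hchain.measurableSet_notMet hdiagMeas) hK hρ0 hρ1 htail hf hl hp ENNReal.ofReal_ne_top
      (fun t => (hmom t).le) hmomZ k
  exact ⟨hfin, fun α _ hα => ⟨l, hα, hfin⟩⟩
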